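/- Fix $d\in\mathbb N$, $s\in(0,1)$, $T>0$ and a scale $\omega:(0,1]\to(0,1]$ with $\omega(\varepsilon)\to0$ as $\varepsilon\to0^+$. Let $a,b,c\in\mathcal D'(\mathbb R^d)$ be real and $u_0\in\mathcal D'(\mathbb R^d)$ complex distributions, and consider the Cauchy problem $$\partial_t u-\nabla\cdot(a\nabla u)+(-\Delta)^{s/2}\bigl(b\,(-\Delta)^{s/2}u\bigr)+c\,u=0\ \text{ in }(0,T)\times\mathbb R^d,\qquad u(0)=u_0. \tag{P}$$ Conventions (all nets are indexed by $\varepsilon\in(0,1]$, all estimates hold for all such $\varepsilon$). - $(-\Delta)^{s/2}$ is the Fourier multiplier with symbol $|\xi|^s$ (for $\hat v(\xi)=\int e^{-ix\cdot\xi}v(x)\,dx$). For real $a,b,c\in L^\infty(\mathbb R^d)$ and $v,\varphi\in H^1(\mathbb R^d)$ put $$B(v,\varphi)=\int a\,\nabla v\cdot\overline{\nabla\varphi}+\int b\,(-\Delta)^{s/2}v\;\overline{(-\Delta)^{s/2}\varphi}+\int c\,v\,\overline{\varphi}.$$ For $u_0\in H^1(\mathbb R^d)$, a weak solution of (P) with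 these bounded coefficients is a function $u\in L^2(0,T;H^1(\mathbb R^d))$ with $u_t\in L^2(0,T;(H^1(\mathbb R^d))')$, $\langle u_t(t),\varphi\rangle+B(u(t),\varphi)=0$ for a.e. $t\in(0,T)$ and all $\varphi\in H^1(\mathbb R^d)$, and $u(0)=u_0$ for the representative of $u$ in $C([0,T];L^2(\mathbb R^d))$. - A net $(g_\varepsilon)$ of functions in $L^\infty(\mathbb R^d)$ is $L^\infty$-moderate if for every compact $K\subset\mathbb R^d$ there are $C>0$, $N\in\mathbb N_0$ with $\|g_\varepsilon\|_{L^\infty(K)}\le C\omega(\varepsilon)^{-N}$. A net $(r_\varepsilon)\subset H^1(\mathbb R^d)$ is $H^1(\mathbb R^d)$-moderate if there are $C>0$, $N\in\mathbb N_0$ with $\|r_\varepsilon\|_{H^1(\mathbb R^d)}\le C\omega(\varepsilon)^{-N}$. A net $(u_\varepsilon)$ is $L^\infty(0,T;H^1)$-moderate if for every compact $K$ there are $C>0$, $N\in\mathbb N_0$ with $\|u_\varepsilon\|_{L^\infty(0,T;H^1(K))}\le C\omega(\varepsilon)^{-N}$. - A net $(g_\varepsilon)$ is negligible in a normed space $X$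 if for every $q\in\mathbb N_0$ there is $C_q>0$ with $\|g_\varepsilon\|_X\le C_q\,\omega(\varepsilon)^q$. - A moderate regularisation of $a$ (likewise $b$, $c$) is an $L^\infty$-moderate net of real functions $a_\varepsilon\in L^\infty(\mathbb R^d)$ with $a_\varepsilon\to a$ in $\mathcal D'(\mathbb R^d)$ as $\varepsilon\to0^+$; a moderate regularisation of $u_0$ is an $H^1(\mathbb R^d)$-moderate net $u_{0,\varepsilon}\in H^1(\mathbb R^d)$ with $u_{0,\varepsilon}\to u_0$ in $\mathcal D'(\mathbb R^d)$. - A net $(u_\varepsilon)$ is a very weak solution of (P), associated with moderate regularisations $(a_\varepsilon,b_\varepsilon,c_\varepsilon,u_{0,\varepsilon})$ of $(a,b,c,u_0)$, if there are constants $a_0,b_0,c_0>0$ such that $a_\varepsilon\ge a_0$, $b_\varepsilon\ge b_0$, $c_\varepsilon\ge c_0$ a.e. on $\mathbb R^d$ for all $\varepsilon$; if each $u_\varepsilon$ is a weak solution of (P) with coefficients $a_\varepsilon,b_\varepsilon,c_\varepsilon$ and initial datum $u_{0,\varepsilon}$; and if $(u_\varepsilon)$ is $L^\infty(0,T;H^1)$-moderate.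 **Theorem (uniqueness of very weak solutions).** Let $(a_\varepsilon,b_\varepsilon,c_\varepsilon,u_{0,\varepsilon})$ and $(\tilde a_\varepsilon,\tilde b_\varepsilon,\tilde c_\varepsilon,\tilde u_{0,\varepsilon})$ be two moderate regularisations of $(a,b,c,u_0)$ such that $(a_\varepsilon-\tilde a_\varepsilon)$, $(b_\varepsilon-\tilde b_\varepsilon)$, $(c_\varepsilon-\tilde c_\varepsilon)$ are negligible in $L^\infty(\mathbb R^d)$ and $(u_{0,\varepsilon}-\tilde u_{0,\varepsilon})$ is negligible in $H^1(\mathbb R^d)$. Assume that there are constants $a_0,b_0,c_0>0$ with $a_\varepsilon,\tilde a_\varepsilon\ge a_0$, $b_\varepsilon,\tilde b_\varepsilon\ge b_0$, $c_\varepsilon,\tilde c_\varepsilon\ge c_0$ a.e. on $\mathbb R^d$ for all $\varepsilon$. For each $\varepsilon$ let $u_\varepsilon$ and $\tilde u_\varepsilon$ be weak solutions of the corresponding regularised problems. If both nets $(u_\varepsilon)$ and $(\tilde u_\varepsilon)$ are $L^\infty(0,T;H^1)$-moderate, then $(u_\varepsilon-\tilde u_\varepsilon)$ is negligible in $L^\infty(0,T;L^2(\mathbb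 R^d))\cap L^2(0,T;H^1(\mathbb R^d))$. In particular, the very weak solution is unique up to negligibility: any two very weak solutions of (P) associated with moderate regularisations whose coefficient differences are $L^\infty(\mathbb R^d)$-negligible and whose initial data differ by an $H^1(\mathbb R^d)$-negligible net differ by a net that is negligible in $L^\infty(0,T;L^2(\mathbb R^d))\cap L^2(0,T;H^1(\mathbb R^d))$. -/

import Mathlib

open MeasureTheory Set Filter Topology
open scoped ENNReal FourierTransform SchwartzMap LineDeriv Distributions ComplexConjugate

namespace MixedHeat

/-- The Euclidean space `ℝ^d`. -/
abbrev E (d : ℕ) : Type := EuclideanSpace ℝ (Fin d)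

/-- The complex Hilbert space `L²(ℝ^d)`. -/
abbrev L2 (d : ℕ) : Type := Lp (α := E d) ℂ 2 volume

/-- The Sobolev space `H¹(ℝ^d)`, realised as the graph of the weak gradient: the pairs
`(v, (g₁, …, g_d))` of `L²` functions such that `∂ᵢ v = gᵢ` in the sense of (tempered)
distributions.  The ambient `ℓ²` product gives the norm `(‖v‖² + ∑ᵢ ‖∂ᵢ v‖²)^{1/2}`. -/
noncomputable def H1 (d : ℕ) :
    Submodule ℂ (WithLp 2 (L2 d × PiLp 2 (fun _ : Fin d => L2 d))) where
  carrier := {p | ∀ i : Fin d,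
    ∂_{(EuclideanSpace.single i (1 : ℝ) : E d)} (p.fst : 𝓢'(E d, ℂ)) =
      ((p.snd i : L2 d) : 𝓢'(E d, ℂ))}
  add_mem' {p q} hp hq i := by
    have h1 := hp i
    have h2 := hq i
    simp only [← Lp.toTemperedDistributionCLM_apply] at h1 h2 ⊢
    simp only [WithLp.add_fst, WithLp.add_snd, PiLp.add_apply, map_add, LineDeriv.lineDerivOp_add,
      h1, h2]
  zero_mem' i := by
    simp only [← Lp.toTemperedDistributionCLM_apply]
    simp only [WithLp.zero_fst, WithLp.zero_snd, PiLp.zero_apply, map_zero,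
      LineDeriv.lineDerivOp_zero]
  smul_mem' c p hp i := by
    have h1 := hp i
    simp only [← Lp.toTemperedDistributionCLM_apply] at h1 ⊢
    simp only [WithLp.smul_fst, WithLp.smul_snd, PiLp.smul_apply, map_smul,
      LineDeriv.lineDerivOp_smul, h1]

/-- The `L²` function underlying an element of `H¹`. -/
noncomputable def toL2 {d : ℕ} (v : H1 d) : L2 d := v.1.fst

/-- The weak partial derivative `∂ᵢ v` of an element of `H¹`. -/
noncomputable def grad {d : ℕ} (v : H1 d) (i : Fin d) : L2 d := v.1.snd i

/-- The norm of `H¹(K)`: `(∫_K |v|² + |∇v|²)^{1/2}`. -/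
noncomputable def h1NormOn {d : ℕ} (K : Set (E d)) (v : H1 d) : ℝ :=
  √(∫ x in K, (‖toL2 v x‖ ^ 2 + ∑ i, ‖grad v i x‖ ^ 2))

open Classical in
/-- The Riesz fractional Laplacian `(-Δ)^{s/2}` on `L²(ℝ^d)`, i.e. the Fourier multiplier with symbol
`|ξ|^s` in the convention `v̂(ξ) = ∫ e^{-ix·ξ} v(x) dx`; in the convention
`∫ e^{-2πix·ξ} v(x) dx` of Mathlib the symbol is `(2π|ξ|)^s`.  (It takes the value `0` outside its
natural domain `H^s(ℝ^d)`, which contains `H¹(ℝ^d)` for `0 < s < 1`, see below.) -/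
noncomputable def fracLapHalf {d : ℕ} (s : ℝ) (v : L2 d) : L2 d :=
  if h : MemLp (fun ξ : E d => (((2 * Real.pi * ‖ξ‖) ^ s : ℝ) : ℂ) * (𝓕 v : L2 d) ξ) 2 volume
  then 𝓕⁻ (h.toLp) else 0

/-- On the Fourier side the weak derivative `∂ᵢ` is multiplication by `2πi ξᵢ`. -/
theorem fourier_grad_ae {d : ℕ} (v : H1 d) (i : Fin d) :
    ∀ᵐ ξ : E d, (𝓕 (grad v i) : L2 d) ξ =
      (2 * Real.pi * Complex.I) * ((ξ i : ℝ) : ℂ) * (𝓕 (toL2 v) : L2 d) ξ := by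
  have h2 := congrArg (𝓕 ·) (v.2 i)
  simp only [Lp.fourier_toTemperedDistribution_eq,
    TemperedDistribution.fourier_lineDerivOp_eq] at h2
  have key : ∀ᵐ ξ : E d, (2 * Real.pi * Complex.I) * ((ξ i : ℝ) : ℂ) * (𝓕 (toL2 v) : L2 d) ξ =
      (𝓕 (grad v i) : L2 d) ξ := by
    apply ae_eq_of_integral_contDiff_smul_eq
    · have h3 : LocallyIntegrable ((𝓕 (toL2 v) : L2 d) : E d → ℂ) volume :=
        (Lp.memLp _).locallyIntegrable (by norm_num)
      rw [← locallyIntegrableOn_univ] at h3 ⊢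
      exact h3.continuousOn_mul
        (g := fun ξ : E d => (2 * Real.pi * Complex.I) * ((ξ i : ℝ) : ℂ))
        (Continuous.continuousOn (by fun_prop)) isClosed_univ.isLocallyClosed
    · exact (Lp.memLp _).locallyIntegrable (by norm_num)
    · intro g gs gc
      have hg₁ : HasCompactSupport (Complex.ofRealCLM ∘ g) := gc.comp_left rfl
      have hg₂ : ContDiff ℝ (⊤ : ℕ∞) (Complex.ofRealCLM ∘ g) := by fun_prop
      have h4 := DFunLike.congr_fun h2 (hg₁.toSchwartzMap hg₂)
      have ht : (fun x : E d =>
          ((inner ℝ x (EuclideanSpace.single i (1 : ℝ)) : ℝ) : ℂ)).HasTemperateGrowth := by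
        fun_prop
      simp [ht] at h4
      simp only [Complex.real_smul]
      refine Eq.trans ?_ h4
      rw [← integral_const_mul]
      refine integral_congr_ae (Eventually.of_forall fun x => ?_)
      simp only [toL2, EuclideanSpace.inner_single_right, one_mul, conj_trivial]
      ring
  filter_upwards [key] with ξ h using h.symm

/-- `H¹(ℝ^d)` lies in the domain of `(-Δ)^{s/2}` for `0 ≤ s ≤ 1`. -/
theorem memLp_fracLapHalf {d : ℕ} {s : ℝ} (hs0 : 0 ≤ s) (hs1 : s ≤ 1) (v : H1 d) :
    MemLp (fun ξ : E d => (((2 * Real.pi * ‖ξ‖) ^ s : ℝ) : ℂ) * (𝓕 (toL2 v) : L2 d) ξ) 2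
      volume := by
  have hg : MemLp (fun ξ : E d => ‖(𝓕 (toL2 v) : L2 d) ξ‖ +
      ∑ i, ‖(𝓕 (grad v i) : L2 d) ξ‖) 2 volume :=
    (Lp.memLp _).norm.add (memLp_finsetSum _ fun i _ => (Lp.memLp _).norm)
  refine hg.mono' ?_ ?_
  · refine AEStronglyMeasurable.mul ?_ (Lp.aestronglyMeasurable _)
    exact (Complex.measurable_ofReal.comp (by fun_prop)).aestronglyMeasurable
  · filter_upwards [eventually_all.2 (fourier_grad_ae v)] with ξ h
    have hb : (2 * Real.pi * ‖ξ‖) ^ s ≤ 1 + 2 * Real.pi * ‖ξ‖ := by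
      have h0 : 0 ≤ 2 * Real.pi * ‖ξ‖ := by positivity
      rcases le_total (2 * Real.pi * ‖ξ‖) 1 with h1 | h1
      · exact (Real.rpow_le_one h0 h1 hs0).trans (by linarith)
      · calc _ ≤ (2 * Real.pi * ‖ξ‖) ^ (1 : ℝ) := Real.rpow_le_rpow_of_exponent_le h1 hs1
          _ ≤ _ := by rw [Real.rpow_one]; linarith
    have hn : ‖ξ‖ ≤ ∑ i, |ξ i| := by
      rw [EuclideanSpace.norm_eq]
      refine (Real.sqrt_le_left (Finset.sum_nonneg fun i _ => abs_nonneg _)).2 ?_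
      exact Finset.sum_sq_le_sq_sum_of_nonneg fun i _ => norm_nonneg (ξ i)
    have hp := Real.pi_pos
    rw [norm_mul, Complex.norm_real, Real.norm_of_nonneg (by positivity)]
    calc _ ≤ (1 + 2 * Real.pi * ∑ i, |ξ i|) * ‖(𝓕 (toL2 v) : L2 d) ξ‖ := by
          refine mul_le_mul_of_nonneg_right (hb.trans ?_) (norm_nonneg _)
          gcongr
      _ = _ := by
          simp only [h, norm_mul, Complex.norm_real, Complex.norm_I, Complex.norm_ofNat,
            Real.norm_eq_abs, abs_of_pos hp, mul_one, add_mul, one_mul, Finset.mul_sum,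
            Finset.sum_mul]

/-- The energy form
`B(u,v) = ∫ a ∇u · conj(∇v) + ∫ b (-Δ)^{s/2}u conj((-Δ)^{s/2}v) + ∫ c u conj(v)` on `H¹(ℝ^d)`. -/
noncomputable def energyForm {d : ℕ} (s : ℝ) (a b c : E d → ℝ) (u v : H1 d) : ℂ :=
  (∫ x, (a x : ℂ) * ∑ i, grad u i x * conj (grad v i x)) +
  (∫ x, (b x : ℂ) * (fracLapHalf s (toL2 u) x * conj (fracLapHalf s (toL2 v) x))) +
  (∫ x, (c x : ℂ) * (toL2 u x * conj (toL2 v x)))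

/-- Lebesgue measure on the time interval `(0,T)`. -/
noncomputable def timeMeasure (T : ℝ) : Measure ℝ := volume.restrict (Ioo 0 T)

/-- `(H¹(ℝ^d))'`: bounded conjugate-linear functionals, matching the sesquilinear form.
Since `0 < s < 1`, it is the dual of `H¹ ∩ H^s = H¹`. -/
abbrev DualH1 (d : ℕ) : Type := H1 d →L⋆[ℂ] ℂ

/-- `u' = u_t` in the sense of `(H¹)'`-valued distributions on `(0,T)`, where `L²` is embedded in
`(H¹)'` by `w ↦ (φ ↦ ∫ w conj(φ))`. -/
def IsTimeDeriv {d : ℕ} (T : ℝ) (u : ℝ → H1 d) (u' : ℝ → DualH1 d) : Prop :=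
  ∀ θ : ℝ → ℝ, ContDiff ℝ (⊤ : ℕ∞) θ → HasCompactSupport θ → tsupport θ ⊆ Ioo 0 T → ∀ φ : H1 d,
    ∫ t, ((deriv θ t : ℝ) : ℂ) * inner ℂ (toL2 φ) (toL2 (u t)) ∂(timeMeasure T) =
      -∫ t, ((θ t : ℝ) : ℂ) * u' t φ ∂(timeMeasure T)

/-- `u` is a weak solution on `(0,T)` of
`u_t - ∇·(a∇u) + (-Δ)^{s/2}(b (-Δ)^{s/2}u) + c u = 0`, `u(0) = u₀`:
`u ∈ L²(0,T;H¹)`, `u_t ∈ L²(0,T;(H¹)')`, `⟨u_t(t),φ⟩ + B(u(t),φ) = 0` for a.e. `t` and all `φ ∈ H¹`,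
and the representative of `u` in `C([0,T];L²)` takes the value `u₀` at `t = 0`. -/
structure IsWeakSolution {d : ℕ} (s T : ℝ) (a b c : E d → ℝ) (u₀ : H1 d) (u : ℝ → H1 d) :
    Prop where
  memLp : MemLp u 2 (timeMeasure T)
  equation : ∃ u' : ℝ → DualH1 d, MemLp u' 2 (timeMeasure T) ∧ IsTimeDeriv T u u' ∧
    ∀ᵐ t ∂(timeMeasure T), ∀ φ : H1 d, u' t φ + energyForm s a b c (u t) φ = 0
  initial : ∃ w : ℝ → L2 d, ContinuousOn w (Icc 0 T) ∧
    (∀ᵐ t ∂(timeMeasure T), w t = toL2 (u t)) ∧ w 0 = toL2 u₀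

/-- A regularisation scale `ω : (0,1] → (0,1]` with `ω(ε) → 0` as `ε → 0⁺`. -/
structure IsScale (ω : ℝ → ℝ) : Prop where
  mem_Ioc : ∀ ε ∈ Ioc (0 : ℝ) 1, ω ε ∈ Ioc (0 : ℝ) 1
  tendsto_zero : Tendsto ω (𝓝[>] 0) (𝓝 0)

/-- `L^∞`-moderate nets: polynomial bounds in `ω(ε)⁻¹` on every compact set. -/
def IsLinftyModerate {d : ℕ} (ω : ℝ → ℝ) (g : ℝ → E d → ℝ) : Prop :=
  ∀ K : Set (E d), IsCompact K → ∃ C > 0, ∃ N : ℕ, ∀ ε ∈ Ioc (0 : ℝ) 1,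
    eLpNorm (g ε) ∞ (volume.restrict K) ≤ ENNReal.ofReal (C / ω ε ^ N)

/-- `H¹(ℝ^d)`-moderate nets. -/
def IsH1Moderate {d : ℕ} (ω : ℝ → ℝ) (r : ℝ → H1 d) : Prop :=
  ∃ C > 0, ∃ N : ℕ, ∀ ε ∈ Ioc (0 : ℝ) 1, ‖r ε‖ ≤ C / ω ε ^ N

/-- `L^∞(0,T;H¹)`-moderate nets: polynomial bounds in `L^∞(0,T;H¹(K))` for every compact `K`. -/
def IsLinftyH1Moderate {d : ℕ} (ω : ℝ → ℝ) (T : ℝ) (u : ℝ → ℝ → H1 d) : Prop :=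
  ∀ K : Set (E d), IsCompact K → ∃ C > 0, ∃ N : ℕ, ∀ ε ∈ Ioc (0 : ℝ) 1,
    eLpNorm (fun t => h1NormOn K (u ε t)) ∞ (timeMeasure T) ≤ ENNReal.ofReal (C / ω ε ^ N)

/-- Negligibility, in terms of the net `ε ↦ ‖g_ε‖_X` of norms. -/
def IsNegligible (ω : ℝ → ℝ) (n : ℝ → ℝ≥0∞) : Prop :=
  ∀ q : ℕ, ∃ C > 0, ∀ ε ∈ Ioc (0 : ℝ) 1, n ε ≤ ENNReal.ofReal (C * ω ε ^ q)

/-- The norm of `L^∞(0,T;L²(ℝ^d)) ∩ L²(0,T;H¹(ℝ^d))`. -/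
noncomputable def energyNorm {d : ℕ} (T : ℝ) (w : ℝ → H1 d) : ℝ≥0∞ :=
  eLpNorm (fun t => toL2 (w t)) ∞ (timeMeasure T) + eLpNorm w 2 (timeMeasure T)

/-- The distributional data of the Cauchy problem: real coefficients `a, b, c ∈ 𝓓'(ℝ^d)` and a
(complex-valued) initial datum `u₀ ∈ 𝓓'(ℝ^d)`. -/
structure CauchyData (d : ℕ) where
  a : 𝓓'((⊤ : TopologicalSpace.Opens (E d)), ℝ)
  b : 𝓓'((⊤ : TopologicalSpace.Opens (E d)), ℝ)
  c : 𝓓'((⊤ : TopologicalSpace.Opens (E d)), ℝ)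
  u₀ : 𝓓'((⊤ : TopologicalSpace.Opens (E d)), ℂ)

/-- A quadruple of nets `(a_ε, b_ε, c_ε, u_{0,ε})`. -/
structure Nets (d : ℕ) where
  a : ℝ → E d → ℝ
  b : ℝ → E d → ℝ
  c : ℝ → E d → ℝ
  u₀ : ℝ → H1 d

/-- `g` is an `L^∞`-moderate regularisation of the distribution `S`: each `g_ε` lies in
`L^∞(ℝ^d)`, `g_ε → S` in the sense of distributions, and `g` is `L^∞`-moderate. -/
structure IsCoeffRegularisation {d : ℕ} (ω : ℝ → ℝ)
    (S : 𝓓'((⊤ : TopologicalSpace.Opens (E d)), ℝ)) (g : ℝ → E d → ℝ) : Prop where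
  memLp : ∀ ε ∈ Ioc (0 : ℝ) 1, MemLp (g ε) ∞ volume
  tendsto : ∀ φ : 𝓓((⊤ : TopologicalSpace.Opens (E d)), ℝ),
    Tendsto (fun ε => ∫ x, φ x * g ε x) (𝓝[>] 0) (𝓝 (S φ))
  moderate : IsLinftyModerate ω g

/-- `r` is an `H¹`-moderate regularisation of the distribution `S`: each `r_ε` lies in `H¹(ℝ^d)`,
`r_ε → S` in the sense of distributions, and `r` is `H¹`-moderate. -/
structure IsDatumRegularisation {d : ℕ} (ω : ℝ → ℝ)
    (S : 𝓓'((⊤ : TopologicalSpace.Opens (E d)), ℂ)) (r : ℝ → H1 d) : Prop where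
  tendsto : ∀ φ : 𝓓((⊤ : TopologicalSpace.Opens (E d)), ℝ),
    Tendsto (fun ε => ∫ x, (φ x : ℂ) * toL2 (r ε) x) (𝓝[>] 0) (𝓝 (S φ))
  moderate : IsH1Moderate ω r

/-- The nets `R` are moderate regularisations of the data `D`. -/
structure Nets.IsRegularisation {d : ℕ} (R : Nets d) (ω : ℝ → ℝ) (D : CauchyData d) : Prop where
  a : IsCoeffRegularisation ω D.a R.a
  b : IsCoeffRegularisation ω D.b R.b
  c : IsCoeffRegularisation ω D.c R.c
  u₀ : IsDatumRegularisation ω D.u₀ R.u₀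

/-- Uniform positivity: `a_ε ≥ a₀`, `b_ε ≥ b₀`, `c_ε ≥ c₀` almost everywhere, for all `ε`. -/
def Nets.IsBoundedBelow {d : ℕ} (R : Nets d) (a₀ b₀ c₀ : ℝ) : Prop :=
  ∀ ε ∈ Ioc (0 : ℝ) 1, ∀ᵐ x : E d, a₀ ≤ R.a ε x ∧ b₀ ≤ R.b ε x ∧ c₀ ≤ R.c ε x

/-- The differences of the coefficient nets are `L^∞(ℝ^d)`-negligible and the difference of the
initial nets is `H¹(ℝ^d)`-negligible. -/
structure Nets.Equivalent {d : ℕ} (R R' : Nets d) (ω : ℝ → ℝ) : Prop where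
  a : IsNegligible ω (fun ε => eLpNorm (R.a ε - R'.a ε) ∞ volume)
  b : IsNegligible ω (fun ε => eLpNorm (R.b ε - R'.b ε) ∞ volume)
  c : IsNegligible ω (fun ε => eLpNorm (R.c ε - R'.c ε) ∞ volume)
  u₀ : IsNegligible ω (fun ε => ‖R.u₀ ε - R'.u₀ ε‖ₑ)

/-- For every `ε`, `u_ε` is a weak solution of the problem regularised by the nets `R`. -/
def IsSolutionNet {d : ℕ} (s T : ℝ) (R : Nets d) (u : ℝ → ℝ → H1 d) : Prop :=
  ∀ ε ∈ Ioc (0 : ℝ) 1, IsWeakSolution s T (R.a ε) (R.b ε) (R.c ε) (R.u₀ ε) (u ε)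

/-- `u` is a very weak solution of the Cauchy problem with data `D`, obtained from the regularising
nets `R`. -/
structure IsVeryWeakSolutionFor {d : ℕ} (ω : ℝ → ℝ) (s T : ℝ) (D : CauchyData d) (R : Nets d)
    (u : ℝ → ℝ → H1 d) : Prop where
  regularisation : R.IsRegularisation ω D
  positivity : ∃ a₀ > 0, ∃ b₀ > 0, ∃ c₀ > 0, R.IsBoundedBelow a₀ b₀ c₀
  solution : IsSolutionNet s T R u
  moderate : IsLinftyH1Moderate ω T u

end MixedHeat

namespace MixedHeat

/-! Let `w = u - u'` and let `B`, `B'` be the two energy forms. Then `w` solves the equation of `B`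
with source `-(B - B')(u', ·)`, whose size is at most `η ‖u'‖ ‖·‖` in `H¹`, with `η` a combination
of the `L^∞` norms of the coefficient differences. Both forms are coercive on `H¹` with the same
constant `m`, a lower bound for the coefficients of orders two and zero. The source involves the
global `H¹` norm of `u'`, and this is paid for by the dissipation of `u'` itself: along the
evolution `‖w‖² + κ ‖u'‖²` (`L²` norms), with `κ = η² / (2m²)`, decreases at rate at least `m ‖w‖²`
(`H¹` norm). Hence `w` is bounded by its initial value plus `η / m` times the initial norm of `u'`.
Since `η` is negligible and the initial datum of `u'` is moderate, the product is negligible.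

A weak solution is not differentiable in time with values in `H¹`, so the computation is done for
mollifications in time. The coefficients do not depend on time, so these satisfy the same equation
exactly, away from the endpoints (`IsWeakEvolution.inner_mollifyDeriv`,
`IsWeakEvolution.energy_mollify`). Fatou's lemma and the continuous `L²` representatives then carry
the estimate to the limit and down to the initial time (`IsWeakEvolution.energy`). The Sobolev part
supplies `energyCLM_coercive` and `norm_energyCLM_sub_le`. -/

/-- `u` solves the abstract evolution equation `(ι u)' = -A u` on `(0,T)` in the weak sense, where
`A φ v` stands for the value at `(v, φ)` of the sesquilinear form generating the evolution. -/
structure IsWeakEvolution {V H : Type*} [NormedAddCommGroup V] [NormedSpace ℂ V]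
    [NormedAddCommGroup H] [InnerProductSpace ℂ H] (ι : V →L[ℂ] H) (A : V → V →L[ℂ] ℂ) (T : ℝ)
    (u : ℝ → V) : Prop where
  integrable : IntegrableOn u (Ioo 0 T)
  weak : ∀ θ : ℝ → ℝ, ContDiff ℝ (⊤ : ℕ∞) θ → HasCompactSupport θ → tsupport θ ⊆ Ioo 0 T →
    ∀ φ : V, ∫ t in Ioo 0 T, ((deriv θ t : ℝ) : ℂ) * inner ℂ (ι φ) (ι (u t)) =
      ∫ t in Ioo 0 T, ((θ t : ℝ) : ℂ) * A φ (u t)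

/-- Mollification in time of a function on `(0,T)`, extended by zero. -/
noncomputable def mollify {V : Type*} [NormedAddCommGroup V] [NormedSpace ℂ V]
    (ρ : ContDiffBump (0 : ℝ)) (T : ℝ) (u : ℝ → V) : ℝ → V :=
  convolution (ρ.normed volume) ((Ioo 0 T).indicator u) (ContinuousLinearMap.lsmul ℝ ℝ) volume

/-- The derivative of `mollify ρ T u`. -/
noncomputable def mollifyDeriv {V : Type*} [NormedAddCommGroup V] [NormedSpace ℂ V]
    (ρ : ContDiffBump (0 : ℝ)) (T : ℝ) (u : ℝ → V) : ℝ → V :=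
  convolution (deriv (ρ.normed volume)) ((Ioo 0 T).indicator u)
    (ContinuousLinearMap.lsmul ℝ ℝ) volume

/-! ### Energy inequality for time-mollified evolutions. -/

section Abstract

variable {V H : Type*} [NormedAddCommGroup V] [NormedSpace ℂ V]
  [NormedAddCommGroup H] [InnerProductSpace ℂ H] {ι : V →L[ℂ] H} {A A' : V → V →L[ℂ] ℂ} {T : ℝ}
  {u u' : ℝ → V}

theorem hasDerivAt_mollify (ρ : ContDiffBump (0 : ℝ)) (hu : IntegrableOn u (Ioo 0 T)) (t : ℝ) :
    HasDerivAt (mollify ρ T u) (mollifyDeriv ρ T u t) t :=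
  HasCompactSupport.hasDerivAt_convolution_left _ ρ.hasCompactSupport_normed ρ.contDiff_normed
    ((integrable_indicator_iff measurableSet_Ioo).2 hu).locallyIntegrable t

variable [CompleteSpace V]

/-- Bounded functionals commute with the Bochner integral. This brings a convolution into the form
of the integrals in the weak formulation, with the translated and reflected kernel as test function.
-/
theorem clm_convolution_indicator (L : V →L[ℂ] ℂ) {f : ℝ → ℝ} (hf : Continuous f)
    (hfc : HasCompactSupport f) (hu : IntegrableOn u (Ioo 0 T)) (t : ℝ) :
    L (convolution f ((Ioo 0 T).indicator u) (ContinuousLinearMap.lsmul ℝ ℝ) volume t) =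
      ∫ r in Ioo 0 T, ((f (t - r) : ℝ) : ℂ) * L (u r) := by
  have hint : Integrable (fun r => f (t - r) • (Ioo 0 T).indicator u r) := by
    have h1 : Integrable ((Ioo 0 T).indicator u) := (integrable_indicator_iff measurableSet_Ioo).2 hu
    obtain ⟨C, hC⟩ := hfc.exists_bound_of_continuous hf
    exact Integrable.bdd_smul (𝕜 := ℝ) (φ := fun r => f (t - r)) h1 C 
      (hf.comp (by fun_prop)).aestronglyMeasurable
      (Eventually.of_forall fun r => hC (t - r))
  rw [convolution_eq_swap]
  simp only [ContinuousLinearMap.lsmul_apply]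
  rw [← L.integral_comp_comm hint, ← integral_indicator measurableSet_Ioo]
  refine integral_congr_ae (Eventually.of_forall fun r => ?_)
  by_cases hr : r ∈ Ioo 0 T
  · simp only [indicator_of_mem hr]
    rw [← Complex.coe_smul, map_smul, smul_eq_mul]
  · simp [indicator_of_notMem hr]

/-- Away from the endpoints, mollification in time turns weak solutions into classical ones. -/
theorem IsWeakEvolution.inner_mollifyDeriv (hu : IsWeakEvolution ι A T u)
    (ρ : ContDiffBump (0 : ℝ)) {t : ℝ} (h0 : ρ.rOut < t) (hT : t < T - ρ.rOut) (φ : V) :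
    inner ℂ (ι φ) (ι (mollifyDeriv ρ T u t)) = -A φ (mollify ρ T u t) := by
  have hsm : ContDiff ℝ (⊤ : ℕ∞) (ρ.normed volume) := ρ.contDiff_normed
  have hcs : HasCompactSupport (ρ.normed volume) := ρ.hasCompactSupport_normed
  have e1 := clm_convolution_indicator ((innerSL ℂ (ι φ)).comp ι) (T := T) (u := u)
    (hsm.continuous_deriv (by norm_num)) hcs.deriv hu.integrable t
  have e2 := clm_convolution_indicator (A φ) (T := T) (u := u)
    hsm.continuous hcs hu.integrable t
  have hsub : tsupport (fun r => ρ.normed volume (t - r)) ⊆ Metric.closedBall t ρ.rOut := by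
    refine closure_minimal (fun r hr => ?_) Metric.isClosed_closedBall
    have h : t - r ∈ Function.support (ρ.normed volume) := hr
    rw [ρ.support_normed_eq, mem_ball_zero_iff] at h
    rw [Metric.mem_closedBall, Real.dist_eq, abs_sub_comm]
    exact h.le
  -- The test function is the reflected kernel centred at `t`; `h0` and `hT` keep its support inside
  -- `(0,T)`. The reflection produces the minus sign of the conclusion.
  have e3 := hu.weak (fun r => ρ.normed volume (t - r)) (hsm.comp (by fun_prop))
    (HasCompactSupport.of_support_subset_isCompact (isCompact_closedBall t ρ.rOut)
      (subset_closure.trans hsub))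
    (hsub.trans fun r hr => by
      rw [Metric.mem_closedBall, Real.dist_eq, abs_le] at hr
      constructor <;> linarith) φ
  have hd : ∀ r, deriv (fun r => ρ.normed volume (t - r)) r = -deriv (ρ.normed volume) (t - r) :=
    fun r => deriv_comp_const_sub _ _ _
  simp only [ContinuousLinearMap.comp_apply, innerSL_apply_apply] at e1
  simp only [mollifyDeriv, mollify]
  rw [e1, e2, ← e3, ← integral_neg]
  refine integral_congr_ae (Eventually.of_forall fun r => ?_)
  simp [hd]

/-- Integrates the differential inequality for `‖ι (p - q)‖² + κ ‖ι q‖²`, where `p`, `q` are the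
mollified solutions. The second summand is there so that its decay absorbs the perturbation `A - A'`
applied to `q`. -/
theorem IsWeakEvolution.energy_mollify (hu : IsWeakEvolution ι A T u)
    (hu' : IsWeakEvolution ι A' T u') {m η : ℝ} (hm : 0 < m)
    (hA : ∀ v, m * ‖v‖ ^ 2 ≤ (A v v).re) (hA' : ∀ v, m * ‖v‖ ^ 2 ≤ (A' v v).re)
    (hη : ∀ φ v, ‖A φ v - A' φ v‖ ≤ η * ‖φ‖ * ‖v‖) (ρ : ContDiffBump (0 : ℝ)) {α β : ℝ}
    (hαβ : α ≤ β) (hα : ρ.rOut < α) (hβ : β < T - ρ.rOut) :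
    ‖ι (mollify ρ T u β - mollify ρ T u' β)‖ ^ 2 +
        m * ∫ t in α..β, ‖mollify ρ T u t - mollify ρ T u' t‖ ^ 2 ≤
      ‖ι (mollify ρ T u α - mollify ρ T u' α)‖ ^ 2 +
        η ^ 2 / (2 * m ^ 2) * ‖ι (mollify ρ T u' α)‖ ^ 2 := by
  set p := mollify ρ T u with hp
  set q := mollify ρ T u' with hq
  set κ := η ^ 2 / (2 * m ^ 2) with hκ
  have dp : ∀ t, HasDerivAt p (mollifyDeriv ρ T u t) t := hasDerivAt_mollify ρ hu.integrable
  have dq : ∀ t, HasDerivAt q (mollifyDeriv ρ T u' t) t := hasDerivAt_mollify ρ hu'.integrable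
  have cp : Continuous p := continuous_iff_continuousAt.2 fun t => (dp t).continuousAt
  have cq : Continuous q := continuous_iff_continuousAt.2 fun t => (dq t).continuousAt
  have dsq : ∀ (f f' : ℝ → V), (∀ t, HasDerivAt f (f' t) t) → ∀ t,
      HasDerivAt (fun t => ‖ι (f t)‖ ^ 2) (2 * (inner ℂ (ι (f t)) (ι (f' t))).re) t := by
    intro f f' hf t
    have h1 : HasDerivAt (fun t => ι (f t)) (ι (f' t)) t :=
      ((ι.restrictScalars ℝ).hasFDerivAt.comp_hasDerivAt t (hf t))
    have h2 := Complex.reCLM.hasFDerivAt.comp_hasDerivAt t (h1.inner ℂ h1)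
    refine (h2.congr_deriv ?_).congr_of_eventuallyEq (Eventually.of_forall fun t => ?_)
    · simp only [Complex.reCLM_apply, Complex.add_re]
      rw [← inner_conj_symm (ι (f' t)) (ι (f t)), Complex.conj_re]
      ring
    · simp only [Function.comp_apply, Complex.reCLM_apply]
      exact (inner_self_eq_norm_sq (𝕜 := ℂ) (ι (f t))).symm
  have dΦ : ∀ t, HasDerivAt (fun t => ‖ι (p t - q t)‖ ^ 2 + κ * ‖ι (q t)‖ ^ 2)
      (2 * (inner ℂ (ι (p t - q t)) (ι (mollifyDeriv ρ T u t - mollifyDeriv ρ T u' t))).re +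
        κ * (2 * (inner ℂ (ι (q t)) (ι (mollifyDeriv ρ T u' t))).re)) t := fun t =>
    (dsq _ _ (fun t => (dp t).sub (dq t)) t).add ((dsq _ _ dq t).const_mul κ)
  have key := intervalIntegral.sub_le_integral_of_hasDeriv_right_of_le hαβ
    (g := fun t => ‖ι (p t - q t)‖ ^ 2 + κ * ‖ι (q t)‖ ^ 2)
    (φ := fun t => -m * ‖p t - q t‖ ^ 2)
    (fun t _ => (dΦ t).continuousAt.continuousWithinAt)
    (fun t _ => (dΦ t).hasDerivWithinAt)
    (Continuous.integrableOn_Icc (by fun_prop)) ?_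
  · rw [intervalIntegral.integral_const_mul] at key
    have : 0 ≤ κ * ‖ι (q β)‖ ^ 2 := by positivity
    linarith
  · intro t ht
    have h0 : ρ.rOut < t := hα.trans ht.1
    have hT : t < T - ρ.rOut := ht.2.trans hβ
    rw [map_sub ι (mollifyDeriv ρ T u t), inner_sub_right, hu.inner_mollifyDeriv ρ h0 hT,
      hu'.inner_mollifyDeriv ρ h0 hT, hu'.inner_mollifyDeriv ρ h0 hT, ← hp, ← hq]
    have h1 := hA (p t - q t)
    have h2 := hA' (q t)
    have h3 := (Complex.abs_re_le_norm _).trans (hη (p t - q t) (q t))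
    -- With `φ = p - q`, this splits `A φ p - A' φ q` into the coercive part `A φ φ` and the
    -- perturbation `(A - A') φ q`.
    have h4 : A (p t - q t) (p t) = A (p t - q t) (p t - q t) + A (p t - q t) (q t) := by
      rw [← map_add, sub_add_cancel]
    have h5 := (abs_le.1 h3).1
    rw [Complex.sub_re] at h5
    simp only [h4, Complex.sub_re, Complex.neg_re, Complex.add_re]
    set x := ‖p t - q t‖
    set y := ‖q t‖
    have h6 : κ * (m * y ^ 2) ≤ κ * (A' (q t) (q t)).re := by gcongr
    -- The value of `κ` is the one that completes this square; half of the coercivity `2m x²` is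
    -- spent here and the other half remains as dissipation.
    have h7 : 0 ≤ m * x ^ 2 - 2 * (η * x * y) + 2 * (κ * (m * y ^ 2)) := by
      have : m * x ^ 2 - 2 * (η * x * y) + 2 * (κ * (m * y ^ 2)) = (m * x - η * y) ^ 2 / m := by
        rw [hκ]; field_simp; ring
      rw [this]; positivity
    linarith

end Abstract

/-! ### Tools for passing to the limit. -/

/-- Fatou's lemma for squared norms, in the form of an upper bound for a Bochner integral. -/
theorem setIntegral_sq_norm_le_of_tendsto {V : Type*} [NormedAddCommGroup V] {f : ℕ → ℝ → V}
    {g : ℝ → V} {α β : ℝ} {r : ℕ → ℝ} {R : ℝ} (hαβ : α ≤ β) (hf : ∀ n, Continuous (f n))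
    (hfg : ∀ᵐ t ∂volume.restrict (Ioc α β), Tendsto (fun n => f n t) atTop (𝓝 (g t)))
    (hg : IntegrableOn (fun t => ‖g t‖ ^ 2) (Ioc α β))
    (hr : ∀ᶠ n in atTop, ∫ t in α..β, ‖f n t‖ ^ 2 ≤ r n) (hR : Tendsto r atTop (𝓝 R)) :
    ∫ t in α..β, ‖g t‖ ^ 2 ≤ R := by
  have hR0 : 0 ≤ R := by
    refine ge_of_tendsto hR (hr.mono fun n hn => le_trans ?_ hn)
    exact intervalIntegral.integral_nonneg hαβ fun t _ => by positivity
  rw [intervalIntegral.integral_of_le hαβ]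
  rw [← ENNReal.ofReal_le_ofReal_iff hR0, ofReal_integral_eq_lintegral_ofReal hg
    (Eventually.of_forall fun t => by positivity)]
  have h1 : ∫⁻ t in Ioc α β, ENNReal.ofReal (‖g t‖ ^ 2) ≤
      liminf (fun n => ∫⁻ t in Ioc α β, ENNReal.ofReal (‖f n t‖ ^ 2)) atTop := by
    refine le_trans (lintegral_mono_ae ?_) (lintegral_liminf_le fun n => ?_)
    · filter_upwards [hfg] with t ht
      exact (ENNReal.tendsto_ofReal (ht.norm.pow 2)).liminf_eq.ge
    · exact ENNReal.measurable_ofReal.comp ((hf n).norm.pow 2).measurable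
  refine h1.trans (le_trans (liminf_le_liminf ?_) (ENNReal.tendsto_ofReal hR).liminf_eq.le)
  filter_upwards [hr] with n hn
  have hi : IntegrableOn (fun t => ‖f n t‖ ^ 2) (Ioc α β) := ((hf n).norm.pow 2).integrableOn_Ioc
  rw [← ofReal_integral_eq_lintegral_ofReal hi
    (Eventually.of_forall fun t => by positivity), ← intervalIntegral.integral_of_le hαβ]
  exact ENNReal.ofReal_le_ofReal hn

/-- An inequality between continuous functions on `[a,b]` holds everywhere if it holds almost
everywhere. -/
theorem le_on_Icc_of_ae {f g : ℝ → ℝ} {a b : ℝ} (hab : a < b) (hf : ContinuousOn f (Icc a b))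
    (hg : ContinuousOn g (Icc a b)) (h : ∀ᵐ t ∂volume.restrict (Ioo a b), f t ≤ g t) {t : ℝ}
    (ht : t ∈ Icc a b) : f t ≤ g t := by
  -- Writing `f ≤ g` as `min f g = f` reduces the claim to the uniqueness of continuous
  -- representatives.
  have h' : (fun t => min (f t) (g t)) =ᵐ[volume.restrict (Icc a b)] f := by
    rw [← restrict_Ioo_eq_restrict_Icc]
    filter_upwards [h] with t ht using min_eq_left ht
  exact min_eq_left_iff.1 (Measure.eqOn_Icc_of_ae_eq volume hab.ne h' (hf.inf hg) hf ht)

/-- A sequence of bump functions shrinking to the origin. -/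
noncomputable def bumpSeq (n : ℕ) : ContDiffBump (0 : ℝ) where
  rIn := 1 / (n + 1)
  -- The bounded ratio of the radii is what the Lebesgue differentiation argument in
  -- `ae_tendsto_mollify` needs.
  rOut := 2 * (1 / (n + 1))
  rIn_pos := by positivity
  rIn_lt_rOut := by linarith [show (0 : ℝ) < 1 / (n + 1) by positivity]

theorem tendsto_bumpSeq_rOut : Tendsto (fun n => (bumpSeq n).rOut) atTop (𝓝 0) := by
  simpa [bumpSeq] using (tendsto_one_div_add_atTop_nhds_zero_nat (𝕜 := ℝ)).const_mul 2

/-! ### Removal of the mollification and extension to the initial time. -/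

section Abstract

variable {V H : Type*} [NormedAddCommGroup V] [NormedSpace ℂ V]
  [NormedAddCommGroup H] [InnerProductSpace ℂ H] {ι : V →L[ℂ] H} {A A' : V → V →L[ℂ] ℂ} {T : ℝ}
  {u u' : ℝ → V}

theorem continuous_mollify (ρ : ContDiffBump (0 : ℝ)) (hu : IntegrableOn u (Ioo 0 T)) :
    Continuous (mollify ρ T u) :=
  continuous_iff_continuousAt.2 fun t => (hasDerivAt_mollify ρ hu t).continuousAt

variable [CompleteSpace V]

theorem ae_tendsto_mollify (hu : IntegrableOn u (Ioo 0 T)) :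
    ∀ᵐ t ∂volume.restrict (Ioo 0 T),
      Tendsto (fun n => mollify (bumpSeq n) T u t) atTop (𝓝 (u t)) := by
  have h := ContDiffBump.ae_convolution_tendsto_right_of_locallyIntegrable (μ := volume)
    (φ := bumpSeq) (K := 2) tendsto_bumpSeq_rOut (Eventually.of_forall fun n => le_rfl)
    ((integrable_indicator_iff measurableSet_Ioo).2 hu).locallyIntegrable
  filter_upwards [ae_restrict_of_ae h, ae_restrict_mem measurableSet_Ioo] with t ht hm
  rwa [indicator_of_mem hm] at ht

/-- The endpoint terms of `energy_mollify` converge when `α` and `β` are points where the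
mollifications converge; the integral passes to the limit only as an inequality, by Fatou, which is
the direction required. -/
theorem IsWeakEvolution.energy_ae (hu : IsWeakEvolution ι A T u)
    (hu' : IsWeakEvolution ι A' T u') (hi : IntegrableOn (fun t => ‖u t - u' t‖ ^ 2) (Ioo 0 T))
    {m η : ℝ} (hm : 0 < m)
    (hA : ∀ v, m * ‖v‖ ^ 2 ≤ (A v v).re) (hA' : ∀ v, m * ‖v‖ ^ 2 ≤ (A' v v).re)
    (hη : ∀ φ v, ‖A φ v - A' φ v‖ ≤ η * ‖φ‖ * ‖v‖) :
    ∀ᵐ α ∂volume.restrict (Ioo 0 T), ∀ᵐ β ∂volume.restrict (Ioo 0 T), α ≤ β →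
    ‖ι (u β - u' β)‖ ^ 2 + m * ∫ t in α..β, ‖u t - u' t‖ ^ 2 ≤
      ‖ι (u α - u' α)‖ ^ 2 + η ^ 2 / (2 * m ^ 2) * ‖ι (u' α)‖ ^ 2 := by
  have hp := ae_tendsto_mollify hu.integrable
  have hq := ae_tendsto_mollify hu'.integrable
  filter_upwards [hp, hq, ae_restrict_mem measurableSet_Ioo] with α hpα hqα hα
  filter_upwards [hp, hq, ae_restrict_mem measurableSet_Ioo] with β hpβ hqβ hβ hαβ
  have hsub : Ioc α β ⊆ Ioo 0 T := fun t ht => ⟨hα.1.trans ht.1, ht.2.trans_lt hβ.2⟩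
  have lim : ∀ {t : ℝ}, Tendsto (fun n => mollify (bumpSeq n) T u t) atTop (𝓝 (u t)) →
      Tendsto (fun n => mollify (bumpSeq n) T u' t) atTop (𝓝 (u' t)) →
      Tendsto (fun n => ‖ι (mollify (bumpSeq n) T u t - mollify (bumpSeq n) T u' t)‖ ^ 2) atTop
        (𝓝 (‖ι (u t - u' t)‖ ^ 2)) := fun h1 h2 =>
    (((ι.continuous.tendsto _).comp (h1.sub h2)).norm.pow 2)
  have key := setIntegral_sq_norm_le_of_tendsto (g := fun t => u t - u' t) hαβ
    (f := fun n t => mollify (bumpSeq n) T u t - mollify (bumpSeq n) T u' t)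
    (fun n => (continuous_mollify _ hu.integrable).sub (continuous_mollify _ hu'.integrable))
    (by
      filter_upwards [ae_restrict_of_ae_restrict_of_subset hsub hp,
        ae_restrict_of_ae_restrict_of_subset hsub hq] with t h1 h2 using h1.sub h2)
    (hi.mono_set hsub)
    (r := fun n => (‖ι (mollify (bumpSeq n) T u α - mollify (bumpSeq n) T u' α)‖ ^ 2 +
        η ^ 2 / (2 * m ^ 2) * ‖ι (mollify (bumpSeq n) T u' α)‖ ^ 2 -
        ‖ι (mollify (bumpSeq n) T u β - mollify (bumpSeq n) T u' β)‖ ^ 2) / m)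
    (by
      filter_upwards [tendsto_bumpSeq_rOut.eventually_lt_const hα.1,
        tendsto_bumpSeq_rOut.eventually_lt_const (sub_pos.2 hβ.2)] with n h1 h2
      rw [le_div_iff₀' hm]
      linarith [hu.energy_mollify hu' hm hA hA' hη (bumpSeq n) hαβ h1 (by linarith)])
    ((((lim hpα hqα).add ((((ι.continuous.tendsto _).comp hqα).norm.pow 2).const_mul _)).sub
      (lim hpβ hqβ)).div_const m)
  rw [le_div_iff₀' hm] at key
  linarith

/-- The energy estimate for the difference of two weak evolutions, up to the initial time. -/
theorem IsWeakEvolution.energy (hu : IsWeakEvolution ι A T u)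
    (hu' : IsWeakEvolution ι A' T u') (hi : IntegrableOn (fun t => ‖u t - u' t‖ ^ 2) (Ioo 0 T))
    {m η : ℝ} (hm : 0 < m)
    (hA : ∀ v, m * ‖v‖ ^ 2 ≤ (A v v).re) (hA' : ∀ v, m * ‖v‖ ^ 2 ≤ (A' v v).re)
    (hη : ∀ φ v, ‖A φ v - A' φ v‖ ≤ η * ‖φ‖ * ‖v‖) (hT : 0 < T) {w w' : ℝ → H}
    (hw : ContinuousOn w (Icc 0 T)) (hw' : ContinuousOn w' (Icc 0 T))
    (hwu : ∀ᵐ t ∂volume.restrict (Ioo 0 T), w t = ι (u t))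
    (hwu' : ∀ᵐ t ∂volume.restrict (Ioo 0 T), w' t = ι (u' t)) {t : ℝ} (ht : t ∈ Icc 0 T) :
    ‖w t - w' t‖ ^ 2 + m * ∫ r in 0..t, ‖u r - u' r‖ ^ 2 ≤
      ‖w 0 - w' 0‖ ^ 2 + η ^ 2 / (2 * m ^ 2) * ‖w' 0‖ ^ 2 := by
  set κ := η ^ 2 / (2 * m ^ 2)
  set I : ℝ → ℝ := fun t => ∫ r in 0..t, ‖u r - u' r‖ ^ 2 with hI
  have hi' : IntegrableOn (fun t => ‖u t - u' t‖ ^ 2) (Icc 0 T) :=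
    (integrableOn_Icc_iff_integrableOn_Ioo).2 hi
  have cI : ContinuousOn I (Icc 0 T) := by
    rw [← uIcc_of_le hT.le] at hi' ⊢
    exact intervalIntegral.continuousOn_primitive_interval hi'
  have hII : ∀ α ∈ Icc 0 T, ∀ β ∈ Icc 0 T, ∫ r in α..β, ‖u r - u' r‖ ^ 2 = I β - I α := by
    have h : ∀ α ∈ Icc 0 T, IntervalIntegrable (fun t => ‖u t - u' t‖ ^ 2) volume 0 α :=
      fun α hα => (intervalIntegrable_iff_integrableOn_Icc_of_le hα.1).2
        (hi'.mono_set (Icc_subset_Icc_right hα.2))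
    exact fun α hα β hβ => (intervalIntegral.integral_interval_sub_left (h β hβ) (h α hα)).symm
  have c1 : ContinuousOn (fun t => ‖w t - w' t‖ ^ 2) (Icc 0 T) := (hw.sub hw').norm.pow 2
  have cF : ContinuousOn (fun t => ‖w t - w' t‖ ^ 2 + m * I t) (Icc 0 T) :=
    c1.add (cI.const_mul m)
  have cG : ContinuousOn (fun t => ‖w t - w' t‖ ^ 2 + κ * ‖w' t‖ ^ 2 + m * I t) (Icc 0 T) :=
    (c1.add ((hw'.norm.pow 2).const_mul κ)).add (cI.const_mul m)
  -- For a fixed good `α`, continuity of `w`, `w'` and `I` in `β` removes the exceptional set of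
  -- endpoints `β`.
  have step : ∀ᵐ α ∂volume.restrict (Ioo 0 T), ∀ β ∈ Icc α T,
      ‖w β - w' β‖ ^ 2 + m * I β ≤ ‖w α - w' α‖ ^ 2 + κ * ‖w' α‖ ^ 2 + m * I α := by
    filter_upwards [hu.energy_ae hu' hi hm hA hA' hη, hwu, hwu',
      ae_restrict_mem measurableSet_Ioo] with α h1 h2 h3 hα
    intro β hβ
    refine le_on_Icc_of_ae (g := fun _ => ‖w α - w' α‖ ^ 2 + κ * ‖w' α‖ ^ 2 + m * I α)
      hα.2 (cF.mono (Icc_subset_Icc_left hα.1.le)) continuousOn_const ?_ hβ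
    have hsub : Ioo α T ⊆ Ioo 0 T := Ioo_subset_Ioo_left hα.1.le
    filter_upwards [ae_restrict_of_ae_restrict_of_subset hsub h1,
      ae_restrict_of_ae_restrict_of_subset hsub hwu,
      ae_restrict_of_ae_restrict_of_subset hsub hwu', ae_restrict_mem measurableSet_Ioo]
      with β h4 h5 h6 hβ
    have h7 := h4 hβ.1.le
    rw [hII α ⟨hα.1.le, hα.2.le⟩ β ⟨hα.1.le.trans hβ.1.le, hβ.2.le⟩, map_sub, map_sub, ← h2, ← h3,
      ← h5, ← h6] at h7
    linarith
  rcases ht.1.eq_or_lt with rfl | ht0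
  · have : 0 ≤ κ * ‖w' 0‖ ^ 2 := by positivity
    simp only [intervalIntegral.integral_same]
    linarith
  -- Now `t` is fixed and the inequality is continuous in `α` on `[0,t]`, so it may be evaluated at
  -- `α = 0`, where `I` vanishes.
  · have h := le_on_Icc_of_ae (f := fun _ => ‖w t - w' t‖ ^ 2 + m * I t) ht0 continuousOn_const
      (cG.mono (Icc_subset_Icc_right ht.2))
      (by
        filter_upwards [ae_restrict_of_ae_restrict_of_subset (Ioo_subset_Ioo_right ht.2) step,
          ae_restrict_mem measurableSet_Ioo] with α h1 h2 using h1 t ⟨h2.2.le, ht.2⟩)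
      (left_mem_Icc.2 ht0.le)
    simpa [hI] using h

end Abstract

/-! ### `H¹` as a Hilbert space and bounded operators from `H¹` to `L²`. -/

section Sobolev

variable {d : ℕ}

/-- Distributional derivatives and the embedding of `L²` into tempered distributions are continuous,
so the graph conditions are closed. The resulting completeness of `H¹` is needed for Bochner
integrals with values in it. -/
theorem isClosed_H1 : IsClosed (H1 d : Set (WithLp 2 (L2 d × PiLp 2 (fun _ : Fin d => L2 d)))) := by
  have h : (H1 d : Set (WithLp 2 (L2 d × PiLp 2 (fun _ : Fin d => L2 d)))) = ⋂ i : Fin d,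
      {p | ∂_{(EuclideanSpace.single i (1 : ℝ) : E d)} (p.fst : 𝓢'(E d, ℂ)) =
        ((p.snd i : L2 d) : 𝓢'(E d, ℂ))} := by
    ext p
    simp only [mem_iInter]
    rfl
  rw [h]
  refine isClosed_iInter fun i => ?_
  simp only [← Lp.toTemperedDistributionCLM_apply]
  refine isClosed_eq ?_ ?_
  · refine (LineDeriv.lineDerivOpCLM ℂ 𝓢'(E d, ℂ)
      (EuclideanSpace.single i (1 : ℝ) : E d)).continuous.comp ?_
    exact (Lp.toTemperedDistributionCLM ℂ volume 2).continuous.comp (WithLp.continuous_fst _ _ _)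
  · exact (Lp.toTemperedDistributionCLM ℂ volume 2).continuous.comp
      ((PiLp.continuous_apply 2 _ i).comp (WithLp.continuous_snd _ _ _))

instance : CompleteSpace (H1 d) := isClosed_H1.completeSpace_coe

theorem norm_sq_H1 (v : H1 d) : ‖v‖ ^ 2 = ‖toL2 v‖ ^ 2 + ∑ i, ‖grad v i‖ ^ 2 := by
  have h : ‖v‖ = ‖(v : WithLp 2 (L2 d × PiLp 2 (fun _ : Fin d => L2 d)))‖ := rfl
  rw [h, WithLp.prod_norm_sq_eq_of_L2, PiLp.norm_sq_eq_of_L2]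
  rfl

theorem norm_toL2_le (v : H1 d) : ‖toL2 v‖ ≤ ‖v‖ := by
  refine le_of_sq_le_sq ?_ (norm_nonneg _)
  rw [norm_sq_H1]
  exact le_add_of_nonneg_right (Finset.sum_nonneg fun i _ => by positivity)

theorem norm_grad_le (v : H1 d) (i : Fin d) : ‖grad v i‖ ≤ ‖v‖ := by
  refine le_of_sq_le_sq ?_ (norm_nonneg _)
  rw [norm_sq_H1]
  exact le_add_of_nonneg_of_le (by positivity)
    (Finset.single_le_sum (f := fun i => ‖grad v i‖ ^ 2) (fun i _ => by positivity)
      (Finset.mem_univ i))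

/-- The inclusion `H¹ → L²`. -/
noncomputable def toL2CLM (d : ℕ) : H1 d →L[ℂ] L2 d :=
  LinearMap.mkContinuous { toFun := toL2, map_add' := fun _ _ => rfl, map_smul' := fun _ _ => rfl } 1
    fun v => (norm_toL2_le v).trans_eq (one_mul _).symm

/-- The weak partial derivative as a bounded operator `H¹ → L²`. -/
noncomputable def gradCLM (i : Fin d) : H1 d →L[ℂ] L2 d :=
  LinearMap.mkContinuous
    { toFun := fun v => grad v i, map_add' := fun _ _ => rfl, map_smul' := fun _ _ => rfl } 1
    fun v => (norm_grad_le v i).trans_eq (one_mul _).symm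

@[simp]
theorem toL2CLM_apply (v : H1 d) : toL2CLM d v = toL2 v := rfl

@[simp]
theorem gradCLM_apply (i : Fin d) (v : H1 d) : gradCLM i v = grad v i := rfl

theorem memLp_mul_L2 {a : E d → ℝ} (ha : MemLp a ∞ volume) (f : L2 d) :
    MemLp (fun x => (a x : ℂ) * f x) 2 volume :=
  (Lp.memLp f).mul (r := 2) ha.ofReal

/-- Multiplication by a bounded real function on `L²`. -/
noncomputable def mulL2 (a : E d → ℝ) (ha : MemLp a ∞ volume) : L2 d →L[ℂ] L2 d :=
  LinearMap.mkContinuous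
    { toFun := fun f => (memLp_mul_L2 ha f).toLp
      map_add' := fun f g => by
        rw [← MemLp.toLp_add]
        refine MemLp.toLp_congr _ _ ?_
        filter_upwards [Lp.coeFn_add f g] with x hx
        rw [hx, Pi.add_apply, mul_add, Pi.add_apply]
      map_smul' := fun z f => by
        rw [RingHom.id_apply, ← MemLp.toLp_const_smul]
        refine MemLp.toLp_congr _ _ ?_
        filter_upwards [Lp.coeFn_smul z f] with x hx
        rw [hx, Pi.smul_apply, Pi.smul_apply, smul_eq_mul, smul_eq_mul, mul_left_comm] }
    (eLpNorm a ∞ volume).toReal fun f => by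
      refine Lp.norm_le_mul_norm_of_ae_le_mul ?_
      filter_upwards [MemLp.coeFn_toLp (memLp_mul_L2 ha f),
        ae_le_eLpNormEssSup (f := a) (μ := volume)] with x h1 h2
      simp only [LinearMap.coe_mk, AddHom.coe_mk]
      rw [h1, norm_mul, Complex.norm_real]
      gcongr
      rw [← toReal_enorm, eLpNorm_exponent_top]
      exact ENNReal.toReal_mono (by simpa using ha.eLpNorm_ne_top) h2

theorem mulL2_coeFn (a : E d → ℝ) (ha : MemLp a ∞ volume) (f : L2 d) :
    mulL2 a ha f =ᵐ[volume] fun x => (a x : ℂ) * f x :=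
  MemLp.coeFn_toLp (memLp_mul_L2 ha f)

theorem norm_mulL2_le (a : E d → ℝ) (ha : MemLp a ∞ volume) (f : L2 d) :
    ‖mulL2 a ha f‖ ≤ (eLpNorm a ∞ volume).toReal * ‖f‖ :=
  (mulL2 a ha).le_of_opNorm_le (LinearMap.mkContinuous_norm_le _ ENNReal.toReal_nonneg _) f

theorem mulL2_sub (a a' : E d → ℝ) (ha : MemLp a ∞ volume) (ha' : MemLp a' ∞ volume) (f : L2 d) :
    mulL2 a ha f - mulL2 a' ha' f = mulL2 (a - a') (ha.sub ha') f := by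
  refine Lp.ext ?_
  filter_upwards [Lp.coeFn_sub (mulL2 a ha f) (mulL2 a' ha' f), mulL2_coeFn a ha f,
    mulL2_coeFn a' ha' f, mulL2_coeFn (a - a') (ha.sub ha') f] with x h1 h2 h3 h4
  rw [h1, Pi.sub_apply, h2, h3, h4, Pi.sub_apply, Complex.ofReal_sub, sub_mul]

theorem inner_mulL2 (a : E d → ℝ) (ha : MemLp a ∞ volume) (f g : L2 d) :
    inner ℂ g (mulL2 a ha f) = ∫ x, (a x : ℂ) * (f x * conj (g x)) := by
  rw [L2.inner_def]
  refine integral_congr_ae ?_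
  filter_upwards [mulL2_coeFn a ha f] with x hx
  rw [hx, RCLike.inner_apply, mul_assoc]

theorem integrable_mul_mul_conj (a : E d → ℝ) (ha : MemLp a ∞ volume) (f g : L2 d) :
    Integrable (fun x => (a x : ℂ) * (f x * conj (g x))) := by
  refine (L2.integrable_inner (𝕜 := ℂ) g (mulL2 a ha f)).congr ?_
  filter_upwards [mulL2_coeFn a ha f] with x hx
  rw [hx, RCLike.inner_apply, mul_assoc]

theorem norm_inner_mulL2_le (a : E d → ℝ) (ha : MemLp a ∞ volume) (f g : L2 d) :
    ‖(inner ℂ g (mulL2 a ha f) : ℂ)‖ ≤ (eLpNorm a ∞ volume).toReal * ‖g‖ * ‖f‖ := by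
  refine (norm_inner_le_norm _ _).trans ?_
  calc _ ≤ ‖g‖ * ((eLpNorm a ∞ volume).toReal * ‖f‖) := by gcongr; exact norm_mulL2_le a ha f
    _ = _ := by ring

theorem le_re_inner_mulL2 (a : E d → ℝ) (ha : MemLp a ∞ volume) {a₀ : ℝ}
    (h : ∀ᵐ x, a₀ ≤ a x) (f : L2 d) :
    a₀ * ‖f‖ ^ 2 ≤ (inner ℂ f (mulL2 a ha f) : ℂ).re := by
  have e1 : ‖f‖ ^ 2 = (∫ x, f x * conj (f x)).re := by
    rw [← inner_self_eq_norm_sq (𝕜 := ℂ), L2.inner_def]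
    simp only [RCLike.inner_apply]
    rfl
  have hi : Integrable (fun x => f x * conj (f x)) :=
    (L2.integrable_inner (𝕜 := ℂ) f f).congr (Eventually.of_forall fun x => RCLike.inner_apply _ _)
  have hre : ∀ {F : E d → ℂ}, Integrable F → (∫ x, F x).re = ∫ x, (F x).re := fun hF =>
    (Complex.reCLM.integral_comp_comm hF).symm
  rw [e1, inner_mulL2, hre hi, hre (integrable_mul_mul_conj a ha f f), ← integral_const_mul]
  refine integral_mono_ae (hi.re.const_mul a₀) (integrable_mul_mul_conj a ha f f).re ?_
  filter_upwards [h] with x hx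
  rw [Complex.mul_conj, ← Complex.ofReal_mul, Complex.ofReal_re, Complex.ofReal_re]
  exact mul_le_mul_of_nonneg_right hx (Complex.normSq_nonneg _)

/-- Since `0 ≤ s ≤ 1`, the symbol is at most `1 + 2π|ξ| ≤ 1 + ∑ᵢ 2π|ξᵢ|`, and `2π|ξᵢ|` is the
modulus of the symbol of `∂ᵢ`. -/
theorem norm_fracLapSymbol_ae_le {s : ℝ} (hs0 : 0 ≤ s) (hs1 : s ≤ 1) (v : H1 d) :
    ∀ᵐ ξ : E d, ‖(((2 * Real.pi * ‖ξ‖) ^ s : ℝ) : ℂ) * (𝓕 (toL2 v) : L2 d) ξ‖ ≤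
      ‖(𝓕 (toL2 v) : L2 d) ξ‖ + ∑ i, ‖(𝓕 (grad v i) : L2 d) ξ‖ := by
  filter_upwards [eventually_all.2 (fourier_grad_ae v)] with ξ h
  have hb : (2 * Real.pi * ‖ξ‖) ^ s ≤ 1 + 2 * Real.pi * ‖ξ‖ := by
    have h0 : 0 ≤ 2 * Real.pi * ‖ξ‖ := by positivity
    rcases le_total (2 * Real.pi * ‖ξ‖) 1 with h1 | h1
    · exact (Real.rpow_le_one h0 h1 hs0).trans (by linarith)
    · calc _ ≤ (2 * Real.pi * ‖ξ‖) ^ (1 : ℝ) := Real.rpow_le_rpow_of_exponent_le h1 hs1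
        _ ≤ _ := by rw [Real.rpow_one]; linarith
  have hn : ‖ξ‖ ≤ ∑ i, |ξ i| := by
    rw [EuclideanSpace.norm_eq]
    refine (Real.sqrt_le_left (Finset.sum_nonneg fun i _ => abs_nonneg _)).2 ?_
    exact Finset.sum_sq_le_sq_sum_of_nonneg fun i _ => norm_nonneg (ξ i)
  have hp := Real.pi_pos
  rw [norm_mul, Complex.norm_real, Real.norm_of_nonneg (by positivity)]
  calc _ ≤ (1 + 2 * Real.pi * ∑ i, |ξ i|) * ‖(𝓕 (toL2 v) : L2 d) ξ‖ := by
        refine mul_le_mul_of_nonneg_right (hb.trans ?_) (norm_nonneg _)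
        gcongr
    _ = _ := by
        simp only [h, norm_mul, Complex.norm_real, Complex.norm_I, Complex.norm_ofNat,
          Real.norm_eq_abs, abs_of_pos hp, mul_one, add_mul, one_mul, Finset.mul_sum,
          Finset.sum_mul]

/-- Multiplication of `𝓕 v` by the symbol of `(-Δ)^{s/2}`. -/
noncomputable def fracLapSymbol {s : ℝ} (hs0 : 0 ≤ s) (hs1 : s ≤ 1) (v : H1 d) : L2 d :=
  (memLp_fracLapHalf hs0 hs1 v).toLp

theorem fracLapHalf_toL2 {s : ℝ} (hs0 : 0 ≤ s) (hs1 : s ≤ 1) (v : H1 d) :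
    fracLapHalf s (toL2 v) = 𝓕⁻ (fracLapSymbol hs0 hs1 v) :=
  dif_pos (memLp_fracLapHalf hs0 hs1 v)

/-- Minkowski and Plancherel applied to the pointwise bound: one term for `v` and one for each of
its `d` derivatives. -/
theorem norm_fracLapSymbol_le {s : ℝ} (hs0 : 0 ≤ s) (hs1 : s ≤ 1) (v : H1 d) :
    ‖fracLapSymbol hs0 hs1 v‖ ≤ (1 + d) * ‖v‖ := by
  have hm : ∀ f : L2 d, MemLp (fun ξ => ‖(𝓕 f : L2 d) ξ‖) 2 volume := fun f => (Lp.memLp _).norm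
  have hn : ∀ f : L2 d, eLpNorm (fun ξ => ‖(𝓕 f : L2 d) ξ‖) 2 volume = ENNReal.ofReal ‖f‖ := by
    intro f
    rw [eLpNorm_norm, ← Lp.enorm_def, ← ofReal_norm, Lp.norm_fourier_eq]
  rw [fracLapSymbol, Lp.norm_toLp]
  refine ENNReal.toReal_le_of_le_ofReal (by positivity) ?_
  calc _ ≤ eLpNorm ((fun ξ : E d => ‖(𝓕 (toL2 v) : L2 d) ξ‖) +
        ∑ i, fun ξ => ‖(𝓕 (grad v i) : L2 d) ξ‖) 2 volume := by
        refine eLpNorm_mono_ae ?_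
        filter_upwards [norm_fracLapSymbol_ae_le hs0 hs1 v] with ξ h
        simp only [Pi.add_apply, Finset.sum_apply]
        exact h.trans (Real.le_norm_self _)
    _ ≤ ENNReal.ofReal ‖toL2 v‖ + ∑ i, ENNReal.ofReal ‖grad v i‖ := by
        refine (eLpNorm_add_le (hm _).1 (memLp_finsetSum' _ fun i _ => hm _).1 (by norm_num)).trans ?_
        rw [hn]
        gcongr
        refine (eLpNorm_sum_le (fun i _ => (hm _).1) (by norm_num)).trans ?_
        simp [hn]
    _ ≤ ENNReal.ofReal ‖v‖ + ∑ _i : Fin d, ENNReal.ofReal ‖v‖ := by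
        gcongr with i
        · exact norm_toL2_le v
        · exact norm_grad_le v i
    _ = _ := by
        rw [ENNReal.ofReal_mul (by positivity), ENNReal.ofReal_add zero_le_one (by positivity)]
        simp [add_mul]

/-- `(-Δ)^{s/2}` as a bounded operator `H¹ → L²`. -/
noncomputable def fracLapCLM {s : ℝ} (hs0 : 0 ≤ s) (hs1 : s ≤ 1) : H1 d →L[ℂ] L2 d :=
  LinearMap.mkContinuous
    { toFun := fun v => fracLapHalf s (toL2 v)
      map_add' := fun v w => by
        simp only [fracLapHalf_toL2 hs0 hs1]
        rw [← FourierTransform.fourierInv_add]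
        congr 1
        simp only [fracLapSymbol]
        rw [← MemLp.toLp_add]
        refine MemLp.toLp_congr _ _ ?_
        have e : (𝓕 (toL2 (v + w)) : L2 d) = 𝓕 (toL2 v) + 𝓕 (toL2 w) :=
          FourierTransform.fourier_add _ _
        rw [e]
        filter_upwards [Lp.coeFn_add (𝓕 (toL2 v) : L2 d) (𝓕 (toL2 w))] with x hx
        rw [hx, Pi.add_apply, mul_add, Pi.add_apply]
      map_smul' := fun z v => by
        simp only [fracLapHalf_toL2 hs0 hs1]
        rw [RingHom.id_apply, ← FourierTransform.fourierInv_smul]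
        congr 1
        simp only [fracLapSymbol]
        rw [← MemLp.toLp_const_smul]
        refine MemLp.toLp_congr _ _ ?_
        have e : (𝓕 (toL2 (z • v)) : L2 d) = z • 𝓕 (toL2 v) :=
          FourierTransform.fourier_smul _ _
        rw [e]
        filter_upwards [Lp.coeFn_smul z (𝓕 (toL2 v) : L2 d)] with x hx
        rw [hx, Pi.smul_apply, Pi.smul_apply, smul_eq_mul, smul_eq_mul, mul_left_comm] }
    (1 + d) fun v => by
      simp only [LinearMap.coe_mk, AddHom.coe_mk, fracLapHalf_toL2 hs0 hs1]
      rw [← Lp.norm_fourier_eq, FourierTransform.fourier_fourierInv_eq]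
      exact norm_fracLapSymbol_le hs0 hs1 v

@[simp]
theorem fracLapCLM_apply {s : ℝ} (hs0 : 0 ≤ s) (hs1 : s ≤ 1) (v : H1 d) :
    fracLapCLM hs0 hs1 v = fracLapHalf s (toL2 v) := rfl

theorem norm_fracLapHalf_le {s : ℝ} (hs0 : 0 ≤ s) (hs1 : s ≤ 1) (v : H1 d) :
    ‖fracLapHalf s (toL2 v)‖ ≤ (1 + d) * ‖v‖ :=
  (fracLapCLM hs0 hs1).le_of_opNorm_le (LinearMap.mkContinuous_norm_le _ (by positivity) _) v

end Sobolev

/-! ### Coercivity and coefficient dependence of the energy form; stability of weak solutions. -/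

section EnergyForm

variable {d : ℕ} {s T : ℝ}

/-- For fixed `φ ∈ H¹`, the energy form as a bounded linear functional of its first argument. -/
noncomputable def energyCLM (hs0 : 0 ≤ s) (hs1 : s ≤ 1) {a b c : E d → ℝ} (ha : MemLp a ∞ volume)
    (hb : MemLp b ∞ volume) (hc : MemLp c ∞ volume) (φ : H1 d) : H1 d →L[ℂ] ℂ :=
  (∑ i, (innerSL ℂ (grad φ i)).comp ((mulL2 a ha).comp (gradCLM i))) +
    (innerSL ℂ (fracLapHalf s (toL2 φ))).comp ((mulL2 b hb).comp (fracLapCLM hs0 hs1)) +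
    (innerSL ℂ (toL2 φ)).comp ((mulL2 c hc).comp (toL2CLM d))

theorem energyCLM_apply_eq_inner (hs0 : 0 ≤ s) (hs1 : s ≤ 1) {a b c : E d → ℝ}
    (ha : MemLp a ∞ volume) (hb : MemLp b ∞ volume) (hc : MemLp c ∞ volume) (φ v : H1 d) :
    energyCLM hs0 hs1 ha hb hc φ v = (∑ i, inner ℂ (grad φ i) (mulL2 a ha (grad v i))) +
      inner ℂ (fracLapHalf s (toL2 φ)) (mulL2 b hb (fracLapHalf s (toL2 v))) +
      inner ℂ (toL2 φ) (mulL2 c hc (toL2 v)) := by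
  simp only [energyCLM, add_apply, sum_apply,
    ContinuousLinearMap.comp_apply, innerSL_apply_apply, gradCLM_apply, fracLapCLM_apply,
    toL2CLM_apply]

theorem energyCLM_apply (hs0 : 0 ≤ s) (hs1 : s ≤ 1) {a b c : E d → ℝ}
    (ha : MemLp a ∞ volume) (hb : MemLp b ∞ volume) (hc : MemLp c ∞ volume) (φ v : H1 d) :
    energyCLM hs0 hs1 ha hb hc φ v = energyForm s a b c v φ := by
  simp only [energyCLM_apply_eq_inner, inner_mulL2, energyForm]
  rw [← integral_finsetSum _ fun i _ => integrable_mul_mul_conj a ha _ _]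
  simp only [Finset.mul_sum]

/-- The local second-order and zeroth-order terms already control the full `H¹` norm; the fractional
term only has to be nonnegative. -/
theorem energyCLM_coercive (hs0 : 0 ≤ s) (hs1 : s ≤ 1) {a b c : E d → ℝ}
    (ha : MemLp a ∞ volume) (hb : MemLp b ∞ volume) (hc : MemLp c ∞ volume) {m : ℝ}
    (h : ∀ᵐ x, m ≤ a x ∧ 0 ≤ b x ∧ m ≤ c x) (v : H1 d) :
    m * ‖v‖ ^ 2 ≤ (energyCLM hs0 hs1 ha hb hc v v).re := by
  have h1 : ∑ i, m * ‖grad v i‖ ^ 2 ≤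
      ∑ i, (inner ℂ (grad v i) (mulL2 a ha (grad v i)) : ℂ).re :=
    Finset.sum_le_sum fun i _ => le_re_inner_mulL2 a ha (h.mono fun x hx => hx.1) (grad v i)
  have h2 := le_re_inner_mulL2 b hb (h.mono fun x hx => hx.2.1) (fracLapHalf s (toL2 v))
  have h3 := le_re_inner_mulL2 c hc (h.mono fun x hx => hx.2.2) (toL2 v)
  rw [energyCLM_apply_eq_inner, Complex.add_re, Complex.add_re, Complex.re_sum, norm_sq_H1,
    mul_add, Finset.mul_sum]
  linarith

/-- The form is linear in its coefficients, so the difference is the form of the differences. The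
factor `d` counts the partial derivatives, and `(1 + d)²` is the bound for `(-Δ)^{s/2}` used once in
each argument. -/
theorem norm_energyCLM_sub_le (hs0 : 0 ≤ s) (hs1 : s ≤ 1) {a b c a' b' c' : E d → ℝ}
    (ha : MemLp a ∞ volume) (hb : MemLp b ∞ volume) (hc : MemLp c ∞ volume)
    (ha' : MemLp a' ∞ volume) (hb' : MemLp b' ∞ volume) (hc' : MemLp c' ∞ volume) (φ v : H1 d) :
    ‖energyCLM hs0 hs1 ha hb hc φ v - energyCLM hs0 hs1 ha' hb' hc' φ v‖ ≤
      (d * (eLpNorm (a - a') ∞ volume).toReal + (1 + d) ^ 2 * (eLpNorm (b - b') ∞ volume).toReal +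
        (eLpNorm (c - c') ∞ volume).toReal) * ‖φ‖ * ‖v‖ := by
  have e : energyCLM hs0 hs1 ha hb hc φ v - energyCLM hs0 hs1 ha' hb' hc' φ v =
      energyCLM hs0 hs1 (ha.sub ha') (hb.sub hb') (hc.sub hc') φ v := by
    simp only [energyCLM_apply_eq_inner, ← mulL2_sub _ _ ha ha', ← mulL2_sub _ _ hb hb',
      ← mulL2_sub _ _ hc hc', inner_sub_right, Finset.sum_sub_distrib]
    ring
  rw [e, energyCLM_apply_eq_inner]
  have h1 : ‖∑ i, inner ℂ (grad φ i) (mulL2 (a - a') (ha.sub ha') (grad v i))‖ ≤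
      ∑ _i : Fin d, (eLpNorm (a - a') ∞ volume).toReal * ‖φ‖ * ‖v‖ := by
    refine (norm_sum_le _ _).trans (Finset.sum_le_sum fun i _ => ?_)
    refine (norm_inner_mulL2_le _ _ _ _).trans ?_
    gcongr
    · exact norm_grad_le φ i
    · exact norm_grad_le v i
  have h2 : ‖(inner ℂ (fracLapHalf s (toL2 φ))
      (mulL2 (b - b') (hb.sub hb') (fracLapHalf s (toL2 v))) : ℂ)‖ ≤
      (eLpNorm (b - b') ∞ volume).toReal * ((1 + d) * ‖φ‖) * ((1 + d) * ‖v‖) := by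
    refine (norm_inner_mulL2_le _ _ _ _).trans ?_
    gcongr
    · exact norm_fracLapHalf_le hs0 hs1 φ
    · exact norm_fracLapHalf_le hs0 hs1 v
  have h3 : ‖(inner ℂ (toL2 φ) (mulL2 (c - c') (hc.sub hc') (toL2 v)) : ℂ)‖ ≤
      (eLpNorm (c - c') ∞ volume).toReal * ‖φ‖ * ‖v‖ := by
    refine (norm_inner_mulL2_le _ _ _ _).trans ?_
    gcongr
    · exact norm_toL2_le φ
    · exact norm_toL2_le v
  refine (norm_add₃_le.trans (add_le_add_three h1 h2 h3)).trans_eq ?_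
  rw [Finset.sum_const, Finset.card_univ, Fintype.card_fin, nsmul_eq_mul]
  ring

/-- The equation replaces the `(H¹)'`-valued time derivative by the energy form, so the dual space
plays no further role. -/
theorem IsWeakSolution.isWeakEvolution (hs0 : 0 ≤ s) (hs1 : s ≤ 1) {a b c : E d → ℝ}
    (ha : MemLp a ∞ volume) (hb : MemLp b ∞ volume) (hc : MemLp c ∞ volume) {u₀ : H1 d}
    {u : ℝ → H1 d} (hu : IsWeakSolution s T a b c u₀ u) :
    IsWeakEvolution (toL2CLM d) (energyCLM hs0 hs1 ha hb hc) T u := by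
  have : IsFiniteMeasure (timeMeasure T) := by
    unfold timeMeasure
    infer_instance
  refine ⟨hu.memLp.integrable (by norm_num), fun θ h1 h2 h3 φ => ?_⟩
  obtain ⟨u', -, hd, he⟩ := hu.equation
  refine (hd θ h1 h2 h3 φ).trans ?_
  rw [← integral_neg]
  refine integral_congr_ae ?_
  filter_upwards [he] with t ht
  rw [energyCLM_apply, eq_neg_of_add_eq_zero_left (ht φ)]
  ring

/-- Stability of weak solutions with respect to the coefficients and the initial datum. -/
theorem energyNorm_sub_le (hs0 : 0 ≤ s) (hs1 : s ≤ 1) (hT : 0 < T) {a b c a' b' c' : E d → ℝ}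
    (ha : MemLp a ∞ volume) (hb : MemLp b ∞ volume) (hc : MemLp c ∞ volume)
    (ha' : MemLp a' ∞ volume) (hb' : MemLp b' ∞ volume) (hc' : MemLp c' ∞ volume)
    {m : ℝ} (hm : 0 < m) (h : ∀ᵐ x, m ≤ a x ∧ 0 ≤ b x ∧ m ≤ c x)
    (h' : ∀ᵐ x, m ≤ a' x ∧ 0 ≤ b' x ∧ m ≤ c' x) {u₀ u₀' : H1 d} {u u' : ℝ → H1 d}
    (hu : IsWeakSolution s T a b c u₀ u) (hu' : IsWeakSolution s T a' b' c' u₀' u') :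
    energyNorm T (u - u') ≤ ENNReal.ofReal ((1 + 1 / √m) * (‖u₀ - u₀'‖ +
      (d * (eLpNorm (a - a') ∞ volume).toReal + (1 + d) ^ 2 * (eLpNorm (b - b') ∞ volume).toReal +
        (eLpNorm (c - c') ∞ volume).toReal) / m * ‖u₀'‖)) := by
  set η := d * (eLpNorm (a - a') ∞ volume).toReal +
    (1 + d) ^ 2 * (eLpNorm (b - b') ∞ volume).toReal + (eLpNorm (c - c') ∞ volume).toReal with hη
  have hη0 : 0 ≤ η := by positivity
  set X := ‖u₀ - u₀'‖ + η / m * ‖u₀'‖ with hX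
  have hX0 : 0 ≤ X := by positivity
  obtain ⟨w, cw, hw, hw0⟩ := hu.initial
  obtain ⟨w', cw', hw', hw0'⟩ := hu'.initial
  have hmem : MemLp (u - u') 2 (timeMeasure T) := hu.memLp.sub hu'.memLp
  have hi : IntegrableOn (fun t => ‖u t - u' t‖ ^ 2) (Ioo 0 T) := hmem.integrable_norm_pow two_ne_zero
  have key : ∀ t ∈ Icc 0 T, ‖w t - w' t‖ ^ 2 + m * ∫ r in 0..t, ‖u r - u' r‖ ^ 2 ≤ X ^ 2 := by
    intro t ht
    refine ((hu.isWeakEvolution hs0 hs1 ha hb hc).energy (hu'.isWeakEvolution hs0 hs1 ha' hb' hc')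
      hi hm (energyCLM_coercive hs0 hs1 ha hb hc h) (energyCLM_coercive hs0 hs1 ha' hb' hc' h')
      (norm_energyCLM_sub_le hs0 hs1 ha hb hc ha' hb' hc') hT cw cw' hw hw' ht).trans ?_
    have e1 : ‖w 0 - w' 0‖ ≤ ‖u₀ - u₀'‖ := by
      rw [hw0, hw0']
      exact norm_toL2_le (u₀ - u₀')
    have e2 : ‖w' 0‖ ≤ ‖u₀'‖ := by
      rw [hw0']
      exact norm_toL2_le u₀'
    -- The factor `1/2` is given up so that the bound is a sum of two squares, hence at most `X²`.
    calc _ ≤ ‖u₀ - u₀'‖ ^ 2 + η ^ 2 / (1 * m ^ 2) * ‖u₀'‖ ^ 2 := by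
          gcongr
          norm_num
      _ = ‖u₀ - u₀'‖ ^ 2 + (η / m * ‖u₀'‖) ^ 2 := by
          field_simp
      _ ≤ X ^ 2 := by
          rw [hX, add_sq]
          have : 0 ≤ 2 * ‖u₀ - u₀'‖ * (η / m * ‖u₀'‖) := by positivity
          linarith
  have b1 : eLpNorm (fun t => toL2 ((u - u') t)) ∞ (timeMeasure T) ≤ ENNReal.ofReal X := by
    rw [eLpNorm_exponent_top]
    refine eLpNormEssSup_le_of_ae_bound ?_
    filter_upwards [hw, hw', ae_restrict_mem measurableSet_Ioo] with t h1 h2 ht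
    have h3 := key t ⟨ht.1.le, ht.2.le⟩
    rw [h1, h2] at h3
    have h4 : 0 ≤ m * ∫ r in 0..t, ‖u r - u' r‖ ^ 2 :=
      mul_nonneg hm.le (intervalIntegral.integral_nonneg ht.1.le fun r _ => by positivity)
    exact le_of_sq_le_sq (show ‖toL2 (u t) - toL2 (u' t)‖ ^ 2 ≤ X ^ 2 by linarith) hX0
  have b2 : eLpNorm (u - u') 2 (timeMeasure T) ≤ ENNReal.ofReal (1 / √m * X) := by
    rw [hmem.eLpNorm_eq_integral_rpow_norm two_ne_zero ENNReal.ofNat_ne_top]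
    refine ENNReal.ofReal_le_ofReal ?_
    -- At `t = T` the dissipation term is `m` times the squared `L²(0,T;H¹)` norm of the difference,
    -- whence the factor `1 / √m`.
    have h3 := key T ⟨hT.le, le_rfl⟩
    have h4 : 0 ≤ ‖w T - w' T‖ ^ 2 := by positivity
    rw [intervalIntegral.integral_of_le hT.le, integral_Ioc_eq_integral_Ioo] at h3
    have h5 : ∫ t, ‖(u - u') t‖ ^ (2 : ℝ≥0∞).toReal ∂(timeMeasure T) =
        ∫ r in Ioo 0 T, ‖u r - u' r‖ ^ 2 := by
      simp [timeMeasure]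
    rw [h5, ENNReal.toReal_ofNat, ← one_div, ← Real.sqrt_eq_rpow]
    refine Real.sqrt_le_iff.2 ⟨by positivity, ?_⟩
    rw [mul_pow, div_pow, Real.sq_sqrt hm.le, one_pow, one_div_mul_eq_div, le_div_iff₀' hm]
    linarith
  calc energyNorm T (u - u') ≤ ENNReal.ofReal X + ENNReal.ofReal (1 / √m * X) := add_le_add b1 b2
    _ = _ := by rw [← ENNReal.ofReal_add hX0 (by positivity), add_mul, one_mul]

end EnergyForm

/-! ### From the stability estimate to negligibility. -/

theorem Nets.IsBoundedBelow.mono {d : ℕ} {R : Nets d} {a₀ b₀ c₀ a₁ b₁ c₁ : ℝ}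
    (h : R.IsBoundedBelow a₀ b₀ c₀) (ha : a₁ ≤ a₀) (hb : b₁ ≤ b₀) (hc : c₁ ≤ c₀) :
    R.IsBoundedBelow a₁ b₁ c₁ := fun ε hε =>
  (h ε hε).mono fun _ hx => ⟨ha.trans hx.1, hb.trans hx.2.1, hc.trans hx.2.2⟩

theorem IsNegligible.toReal_le {ω : ℝ → ℝ} {n : ℝ → ℝ≥0∞} (hω : IsScale ω)
    (h : IsNegligible ω n) (q : ℕ) :
    ∃ C > 0, ∀ ε ∈ Ioc (0 : ℝ) 1, (n ε).toReal ≤ C * ω ε ^ q := by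
  obtain ⟨C, hC, h⟩ := h q
  exact ⟨C, hC, fun ε hε => ENNReal.toReal_le_of_le_ofReal
    (mul_nonneg hC.le (pow_nonneg (hω.mem_Ioc ε hε).1.le q)) (h ε hε)⟩

theorem isNegligible_energyNorm_sub {d : ℕ} {s T : ℝ} (hs : s ∈ Ioo (0 : ℝ) 1) (hT : 0 < T)
    {ω : ℝ → ℝ} (hω : IsScale ω) {D : CauchyData d} {R R' : Nets d} (hR : R.IsRegularisation ω D)
    (hR' : R'.IsRegularisation ω D) (hRR' : R.Equivalent R' ω) {a₀ b₀ c₀ : ℝ} (ha₀ : 0 < a₀)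
    (hb₀ : 0 < b₀) (hc₀ : 0 < c₀) (hB : R.IsBoundedBelow a₀ b₀ c₀)
    (hB' : R'.IsBoundedBelow a₀ b₀ c₀) {u u' : ℝ → ℝ → H1 d} (hu : IsSolutionNet s T R u)
    (hu' : IsSolutionNet s T R' u') : IsNegligible ω (fun ε => energyNorm T (u ε - u' ε)) := by
  intro q
  obtain ⟨C, hC, N, hN⟩ := hR'.u₀.moderate
  -- In the stability estimate the coefficient differences multiply `‖u₀'‖`, which may grow like `ω
  -- ε ^ (-N)`; the extra `N` powers absorb this growth.
  obtain ⟨Ca, hCa, hna⟩ := hRR'.a.toReal_le hω (q + N)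
  obtain ⟨Cb, hCb, hnb⟩ := hRR'.b.toReal_le hω (q + N)
  obtain ⟨Cc, hCc, hnc⟩ := hRR'.c.toReal_le hω (q + N)
  obtain ⟨C₀, hC₀, hn₀⟩ := hRR'.u₀.toReal_le hω q
  have hm : 0 < min a₀ c₀ := lt_min ha₀ hc₀
  refine ⟨(1 + 1 / √(min a₀ c₀)) *
    (C₀ + (d * Ca + (1 + d) ^ 2 * Cb + Cc) / min a₀ c₀ * C), by positivity, fun ε hε => ?_⟩
  have hω0 := (hω.mem_Ioc ε hε).1
  refine (energyNorm_sub_le hs.1.le hs.2.le hT (hR.a.memLp ε hε) (hR.b.memLp ε hε)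
    (hR.c.memLp ε hε) (hR'.a.memLp ε hε) (hR'.b.memLp ε hε) (hR'.c.memLp ε hε) hm
    ((hB.mono (min_le_left _ _) hb₀.le (min_le_right _ _)) ε hε)
    ((hB'.mono (min_le_left _ _) hb₀.le (min_le_right _ _)) ε hε) (hu ε hε) (hu' ε hε)).trans ?_
  refine ENNReal.ofReal_le_ofReal ?_
  have h₀ := hn₀ ε hε
  rw [toReal_enorm] at h₀
  calc _ ≤ (1 + 1 / √(min a₀ c₀)) * (C₀ * ω ε ^ q +
        (d * (Ca * ω ε ^ (q + N)) + (1 + d) ^ 2 * (Cb * ω ε ^ (q + N)) + Cc * ω ε ^ (q + N)) /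
          min a₀ c₀ * (C / ω ε ^ N)) := by
        gcongr
        · exact hna ε hε
        · exact hnb ε hε
        · exact hnc ε hε
        · exact hN ε hε
    _ = _ := by
        rw [pow_add]
        field_simp

end MixedHeat

open MixedHeat in
theorem mainTheorem3 {d : ℕ} {s T : ℝ} (hs : s ∈ Ioo (0 : ℝ) 1) (hT : 0 < T)
    {ω : ℝ → ℝ} (hω : IsScale ω) (D : CauchyData d) :
    (∀ (R R' : Nets d), R.IsRegularisation ω D → R'.IsRegularisation ω D →
      R.Equivalent R' ω →
      ∀ a₀ b₀ c₀ : ℝ, 0 < a₀ → 0 < b₀ → 0 < c₀ →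
      R.IsBoundedBelow a₀ b₀ c₀ → R'.IsBoundedBelow a₀ b₀ c₀ →
      ∀ u u' : ℝ → ℝ → H1 d, IsSolutionNet s T R u → IsSolutionNet s T R' u' →
      IsLinftyH1Moderate ω T u → IsLinftyH1Moderate ω T u' →
      IsNegligible ω (fun ε => energyNorm T (u ε - u' ε))) ∧
    (∀ (R R' : Nets d) (u u' : ℝ → ℝ → H1 d),
      IsVeryWeakSolutionFor ω s T D R u → IsVeryWeakSolutionFor ω s T D R' u' →
      R.Equivalent R' ω → IsNegligible ω (fun ε => energyNorm T (u ε - u' ε))) := by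
  refine ⟨fun R R' hR hR' hRR' a₀ b₀ c₀ ha₀ hb₀ hc₀ hB hB' u u' hu hu' _ _ =>
    isNegligible_energyNorm_sub hs hT hω hR hR' hRR' ha₀ hb₀ hc₀ hB hB' hu hu',
    fun R R' u u' hu hu' hRR' => ?_⟩
  obtain ⟨a₀, ha₀, b₀, hb₀, c₀, hc₀, hB⟩ := hu.positivity
  obtain ⟨a₁, ha₁, b₁, hb₁, c₁, hc₁, hB'⟩ := hu'.positivity
  -- Each very weak solution brings its own positivity constants; their minima serve for both nets.
  exact isNegligible_energyNorm_sub hs hT hω hu.regularisation hu'.regularisation hRR'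
    (lt_min ha₀ ha₁) (lt_min hb₀ hb₁) (lt_min hc₀ hc₁)
    (hB.mono (min_le_left _ _) (min_le_left _ _) (min_le_left _ _))
    (hB'.mono (min_le_right _ _) (min_le_right _ _) (min_le_right _ _)) hu.solution hu'.solution
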